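/- Let $\mathcal{Y}_3=\{\mathsf{y}_1,\mathsf{y}_2,\mathsf{y}_3\}\subset\mathbb{R}^2$ be three non-collinear points, let $T$ be the closed triangle with these vertices, $M_C$ its center of mass, and $e_i$ the edge opposite $\mathsf{y}_i$. Let $R(\mathsf{y}_i)$ be the closed quadrilateral with vertices $\mathsf{y}_i$, the midpoint of one edge at $\mathsf{y}_i$, $M_C$, and the midpoint of the other edge at $\mathsf{y}_i$. For every $x\in T\setminus\mathcal{Y}_3$ fix a vertex $v(x)=\mathsf{y}_i$ with $x\in R(\mathsf{y}_i)$ (chosen arbitrarily if there are several), and for $r\in[1,\infty)$ let $N^r_{PE}(x,M_C)=T_r(x)\cap T$, where $T_r(x)$ is the image of $T$ under the homothety with center $v(x)=\mathsf{y}_i$ for which the edge opposite $\mathsf{y}_i$ lies at distance $r\,d(\mathsf{y}_i,\ell(x))$ from $\mathsf{y}_i$, $\ell(x)$ being the line through $x$ parallel to $e_i$; the homothety ratio is thus $r\,d(\mathsf{y}_i,\ell(x))/d(\mathsf{y}_i,\ell_i)$, with $\ell_i$ the line containing $e_i$. For $x\in\mathcal{Y}_3$ let $N^r_{PE}(x,M_C)=\{x\}$.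 For $B\subseteq\mathbb{R}^2$ let $$\Gamma_1(B,N_{PE}^{r},M_C)=\{z\in T: B\subseteq N^r_{PE}(z,M_C)\}.$$ For each $n$ let $\mathcal{X}_n=\{X_1,\dots,X_n\}$, where $X_1,\dots,X_n$ are independent random points uniformly distributed on $T$. Then, with $A$ denoting area, the random variable $A(\Gamma_1(\mathcal{X}_n,N_{PE}^{3/2},M_C))$ is integrable for every $n$, and its expectation converges to zero at rate $O(n^{-2})$: $$\mathbb{E}\left[A\left(\Gamma_1(\mathcal{X}_n,N_{PE}^{3/2},M_C)\right)\right]\to 0 \quad\text{and}\quad \mathbb{E}\left[A\left(\Gamma_1(\mathcal{X}_n,N_{PE}^{3/2},M_C)\right)\right]=O(n^{-2})\qquad(n\to\infty).$$ -/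

import Mathlib

open MeasureTheory ProbabilityTheory Filter Topology Asymptotics

noncomputable section

namespace ProximityMap

/-- The Euclidean plane `ℝ²`. Its measure `volume` is area. -/
abbrev Plane : Type := EuclideanSpace ℝ (Fin 2)

/-- The closed triangle `T(𝒴₃)` with vertices `y 0, y 1, y 2`. -/
def triangle (y : Fin 3 → Plane) : Set Plane :=
  convexHull ℝ (Set.range y)

/-- The center of mass `M_C` of the triangle. -/
def centerOfMass (y : Fin 3 → Plane) : Plane :=
  Finset.univ.centroid ℝ y

/-- The line spanned by the edge `e_i` opposite to the vertex `y i`. -/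
def edgeLine (y : Fin 3 → Plane) (i : Fin 3) : AffineSubspace ℝ Plane :=
  line[ℝ, y (i + 1), y (i + 2)]

/-- The line `ℓ(y i, x)` through `x` parallel to the edge opposite to `y i`. -/
def parallelLine (y : Fin 3 → Plane) (i : Fin 3) (x : Plane) : AffineSubspace ℝ Plane :=
  AffineSubspace.mk' x (edgeLine y i).direction

/-- The `M_C`-vertex region of `y i`: the (closed) quadrilateral cut out of the triangle by the
segments that join the center of mass to the midpoints of the two edges at `y i`. -/
def vertexRegion (y : Fin 3 → Plane) (i : Fin 3) : Set Plane :=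
  convexHull ℝ {y i, midpoint ℝ (y i) (y (i + 1)), centerOfMass y,
    midpoint ℝ (y i) (y (i + 2))}

/-- `v` assigns to every non-vertex point of the triangle (the index of) a vertex whose
`M_C`-vertex region contains the point; the choice is arbitrary on common boundaries. -/
def IsVertexAssignment (y : Fin 3 → Plane) (v : Plane → Fin 3) : Prop :=
  ∀ x ∈ triangle y \ Set.range y, x ∈ vertexRegion y (v x)

/-- The triangle `T_r(x)` for a point `x` assigned to the vertex `y i`. It has `y i` as a vertex,
is similar to the given triangle with the same orientation, and its edge opposite to `y i` lies on
the line `ℓ_r(y i, x)` parallel to `e_i`, on the side of `x`, at distance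
`r * d(y i, ℓ(y i, x))` from `y i`. So it is the image of the given triangle under the homothety
with center `y i` that multiplies the height over `e_i` by the ratio of that distance to
`d(y i, e_i)`. -/
def scaledTriangle (r : ℝ) (y : Fin 3 → Plane) (i : Fin 3) (x : Plane) : Set Plane :=
  AffineMap.homothety (y i)
    (r * Metric.infDist (y i) (parallelLine y i x : Set Plane) /
      Metric.infDist (y i) (edgeLine y i : Set Plane)) '' triangle y

open Classical in
/-- The proportional-edge proximity map `N_PE^r(·, M_C)` on the triangle, `1 ≤ r < ∞`. -/
def propEdge (r : ℝ) (y : Fin 3 → Plane) (v : Plane → Fin 3) (x : Plane) : Set Plane :=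
  if x ∈ Set.range y then {x} else scaledTriangle r y (v x) x ∩ triangle y

/-- The `Γ₁`-region `{z ∈ S : B ⊆ N z}` of a set `B` for a proximity map `N` on a space `S`. -/
def gammaOne (S : Set Plane) (N : Plane → Set Plane) (B : Set Plane) : Set Plane :=
  {z | z ∈ S ∧ B ⊆ N z}

/-- The area of `Γ₁(B, N_PE^r, M_C)`. -/
def gammaOneArea (r : ℝ) (y : Fin 3 → Plane) (v : Plane → Fin 3) (B : Set Plane) : ℝ :=
  volume.real (gammaOne (triangle y) (propEdge r y v) B)

end ProximityMap

end

/-!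
In barycentric coordinates `λ₀, λ₁, λ₂` the proximity region of a point `z` assigned to the vertex
`i` is the set of points `p` of the triangle with `1 - λᵢ(p) ≤ r (1 - λᵢ(z))`
(`ProximityMap.mem_propEdge_iff`), and `z` can only be assigned to a vertex at which its barycentric
coordinate is largest. Off a null set that vertex is unique, so the arbitrary, possibly
non-measurable, choice of vertices does not affect areas. The `Γ₁`-region of a sample is therefore,
up to a null set, the disjoint union over `i` of the sets of those `z` whose largest coordinate is
the `i`-th and satisfies `1 - mᵢ ≤ r (1 - λᵢ(z))`, where `mᵢ` is the smallest `i`-th coordinate in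
the sample (`ProximityMap.gammaOneArea_eq_sum`).

For `r = 3/2` the condition is `λᵢ(z) ≤ 1/3 + 2mᵢ/3`. All coordinates of `z` are then at most
`1/3 + 2mᵢ/3`, which says that `z` lies in the image of the triangle under the homothety about the
center of mass with ratio `-2mᵢ`. So the area of the `i`-th piece is at most `4 mᵢ² A(T)`
(`ProximityMap.volume_gammaPiece_le`).

The corner `{λᵢ > t}` of the triangle is a copy of it scaled by `1 - t`, so
`P(mᵢ > t) = (1 - t)²ⁿ ≤ exp(-2nt)` for `0 ≤ t ≤ 1` (and `mᵢ ≤ 1`), and integrating this tail gives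
`E[mᵢ²] ≤ 1 / (2n²)` (`ProximityMap.lintegral_sq_iInf_coord_le`). Summing the three pieces, the
expected area is at most `6 A(T) / n²` (`ProximityMap.integral_gammaOneArea_le`).
-/

namespace ProximityMap

/-! ### Barycentric coordinates on the triangle -/

theorem mem_triangle_iff (b : AffineBasis (Fin 3) ℝ Plane) {x : Plane} :
    x ∈ triangle b ↔ ∀ i, 0 ≤ b.coord i x := by
  rw [triangle, b.convexHull_eq_nonneg_coord]; rfl

theorem isCompact_triangle (y : Fin 3 → Plane) : IsCompact (triangle y) :=
  (Set.finite_range y).isCompact_convexHull ℝ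

theorem measurableSet_triangle (y : Fin 3 → Plane) : MeasurableSet (triangle y) :=
  (isCompact_triangle y).isClosed.measurableSet

theorem continuous_coord (b : AffineBasis (Fin 3) ℝ Plane) (i : Fin 3) :
    Continuous (b.coord i) :=
  (b.coord i).continuous_of_finiteDimensional

theorem coord_homothety (b : AffineBasis (Fin 3) ℝ Plane) (i : Fin 3) (c p : Plane) (k : ℝ) :
    b.coord i (AffineMap.homothety c k p) = k * (b.coord i p - b.coord i c) + b.coord i c := by
  rw [AffineMap.homothety_eq_lineMap, AffineMap.apply_lineMap, AffineMap.lineMap_apply_ring]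
  ring

theorem mem_homothety_image_iff {c : Plane} {k : ℝ} (hk : k ≠ 0) {S : Set Plane} {p : Plane} :
    p ∈ AffineMap.homothety c k '' S ↔ AffineMap.homothety c k⁻¹ p ∈ S := by
  have h1 : ∀ q : Plane, AffineMap.homothety c k (AffineMap.homothety c k⁻¹ q) = q := fun q => by
    rw [← AffineMap.homothety_mul_apply, mul_inv_cancel₀ hk, AffineMap.homothety_one]; rfl
  have h2 : ∀ q : Plane, AffineMap.homothety c k⁻¹ (AffineMap.homothety c k q) = q := fun q => by
    rw [← AffineMap.homothety_mul_apply, inv_mul_cancel₀ hk, AffineMap.homothety_one]; rfl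
  constructor
  · rintro ⟨q, hq, rfl⟩
    rwa [h2]
  · exact fun h => ⟨_, h, h1 p⟩

/-- The triangle scaled about its vertex `b i` by `k > 0` meets the given triangle in the points with
`1 - k ≤ λᵢ`. -/
theorem mem_homothety_vertex_iff (b : AffineBasis (Fin 3) ℝ Plane) (i : Fin 3) {k : ℝ}
    (hk : 0 < k) {p : Plane} (hp : p ∈ triangle b) :
    p ∈ AffineMap.homothety (b i) k '' triangle b ↔ 1 - b.coord i p ≤ k := by
  rw [mem_triangle_iff] at hp
  rw [mem_homothety_image_iff hk.ne', mem_triangle_iff]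
  simp only [coord_homothety]
  constructor
  · intro h
    have := h i
    rw [b.coord_apply_eq] at this
    have h2 : k⁻¹ * (1 - b.coord i p) ≤ 1 := by linarith
    rwa [inv_mul_le_iff₀ hk, mul_one] at h2
  · intro h j
    by_cases hj : j = i
    · subst hj
      rw [b.coord_apply_eq]
      have h2 : k⁻¹ * (1 - b.coord j p) ≤ 1 := by rwa [inv_mul_le_iff₀ hk, mul_one]
      linarith
    · rw [b.coord_apply_ne hj]
      have := mul_nonneg (inv_nonneg.2 hk.le) (hp j)
      linarith

theorem coord_lt_one (b : AffineBasis (Fin 3) ℝ Plane) {i : Fin 3} {x : Plane}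
    (hx : x ∈ triangle b) (hx' : x ∉ Set.range b) : b.coord i x < 1 := by
  rw [mem_triangle_iff] at hx
  by_contra! h
  apply hx'
  have hs := b.sum_coord_apply_eq_one x
  refine ⟨i, b.ext_elem fun j => ?_⟩
  rw [Fin.sum_univ_three] at hs
  have h0 := hx 0
  have h1 := hx 1
  have h2 := hx 2
  rw [b.coord_apply]
  fin_cases i <;> fin_cases j <;> simp at h ⊢ <;> linarith

/-! ### Distances to lines parallel to an edge -/

theorem mem_direction_edgeLine_iff (b : AffineBasis (Fin 3) ℝ Plane) (i : Fin 3) (p x : Plane) :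
    p -ᵥ x ∈ (edgeLine b i).direction ↔ b.coord i p = b.coord i x := by
  rw [edgeLine, direction_affineSpan, mem_vectorSpan_pair]
  have hi1 : i ≠ i + 1 := by fin_cases i <;> decide
  have hi2 : i ≠ i + 2 := by fin_cases i <;> decide
  have key : ∀ (t : ℝ) (j : Fin 3), b.coord j (t • (b (i + 1) -ᵥ b (i + 2)) +ᵥ x) =
      t * (b.coord j (b (i + 1)) - b.coord j (b (i + 2))) + b.coord j x := fun t j => by
    rw [AffineMap.map_vadd, map_smul, AffineMap.linearMap_vsub]; rfl
  constructor
  · rintro ⟨t, ht⟩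
    have h := key t i
    rw [ht, vsub_vadd, b.coord_apply_ne hi1, b.coord_apply_ne hi2] at h
    linarith
  · intro h
    refine ⟨b.coord (i + 1) p - b.coord (i + 1) x, ?_⟩
    rw [eq_comm, ← eq_vadd_iff_vsub_eq]
    refine b.ext_elem fun j => ?_
    rw [key]
    have hp := b.sum_coord_apply_eq_one p
    have hx := b.sum_coord_apply_eq_one x
    rw [Fin.sum_univ_three] at hp hx
    simp only [b.coord_apply]
    fin_cases i <;> fin_cases j <;> simp at h ⊢ <;> linarith

theorem mem_parallelLine_iff (b : AffineBasis (Fin 3) ℝ Plane) (i : Fin 3) (p x : Plane) :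
    p ∈ parallelLine b i x ↔ b.coord i p = b.coord i x := by
  rw [parallelLine, AffineSubspace.mem_mk', mem_direction_edgeLine_iff]

theorem mem_edgeLine_iff (b : AffineBasis (Fin 3) ℝ Plane) (i : Fin 3) (p : Plane) :
    p ∈ edgeLine b i ↔ b.coord i p = 0 := by
  have h : b (i + 1) ∈ edgeLine b i := left_mem_affineSpan_pair ℝ _ _
  have hi1 : i ≠ i + 1 := by fin_cases i <;> decide
  rw [← AffineSubspace.mk'_eq h, AffineSubspace.mem_mk', mem_direction_edgeLine_iff,
    b.coord_apply_ne hi1]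

open scoped Pointwise in
theorem infDist_homothety_image (c : Plane) {k : ℝ} (hk : k ≠ 0) (S : Set Plane) :
    Metric.infDist c (AffineMap.homothety c k '' S) = |k| * Metric.infDist c S := by
  have h1 : Isometry fun p : Plane => p - c := by
    intro p q; simp [edist_dist, dist_eq_norm]
  have h2 : (fun p : Plane => p - c) '' (AffineMap.homothety c k '' S) =
      k • ((fun p : Plane => p - c) '' S) := by
    rw [← Set.image_smul, Set.image_image, Set.image_image]
    refine Set.image_congr fun p _ => ?_
    simp [AffineMap.homothety_apply]
  have h3 : k • (c - c) = c - c := by simp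
  rw [← Metric.infDist_image h1, h2, ← h3, infDist_smul₀ hk, Real.norm_eq_abs,
    ← Metric.infDist_image h1 (x := c) (t := S)]

/-- The ratio of the distances of a vertex to the parallel through `x` and to the opposite edge
is read off from the barycentric coordinate of `x` at that vertex: the homothety about the vertex
with this ratio takes the edge line to the parallel. -/
theorem infDist_parallelLine (b : AffineBasis (Fin 3) ℝ Plane) (i : Fin 3) {x : Plane}
    (hx : b.coord i x < 1) :
    Metric.infDist (b i) (parallelLine b i x : Set Plane) =
      (1 - b.coord i x) * Metric.infDist (b i) (edgeLine b i : Set Plane) := by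
  have hk : 0 < 1 - b.coord i x := by linarith
  have h : (parallelLine b i x : Set Plane) =
      AffineMap.homothety (b i) (1 - b.coord i x) '' (edgeLine b i : Set Plane) := by
    ext p
    rw [mem_homothety_image_iff hk.ne', SetLike.mem_coe, SetLike.mem_coe, mem_edgeLine_iff,
      mem_parallelLine_iff, coord_homothety, b.coord_apply_eq]
    constructor
    · intro h
      rw [h]
      field_simp
      ring
    · intro h
      field_simp at h
      linarith
  rw [h, infDist_homothety_image _ hk.ne', abs_of_pos hk]

theorem infDist_edgeLine_pos (b : AffineBasis (Fin 3) ℝ Plane) (i : Fin 3) :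
    0 < Metric.infDist (b i) (edgeLine b i : Set Plane) := by
  have hc : IsClosed (edgeLine b i : Set Plane) := AffineSubspace.closed_of_finiteDimensional _
  refine (hc.notMem_iff_infDist_pos ⟨b (i + 1), left_mem_affineSpan_pair ℝ _ _⟩).1 ?_
  rw [SetLike.mem_coe, mem_edgeLine_iff, b.coord_apply_eq]
  exact one_ne_zero

/-! ### The proximity map in barycentric coordinates -/

theorem mem_propEdge_iff (b : AffineBasis (Fin 3) ℝ Plane) (v : Plane → Fin 3) {r : ℝ}
    (hr : 0 < r) {z p : Plane} (hz : z ∈ triangle b) (hz' : z ∉ Set.range b) :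
    p ∈ propEdge r b v z ↔
      p ∈ triangle b ∧ 1 - b.coord (v z) p ≤ r * (1 - b.coord (v z) z) := by
  have hlt := coord_lt_one b (i := v z) hz hz'
  have hk : 0 < r * (1 - b.coord (v z) z) := mul_pos hr (by linarith)
  rw [propEdge, if_neg hz', Set.mem_inter_iff, and_comm, scaledTriangle,
    infDist_parallelLine b _ hlt, ← mul_assoc, mul_div_cancel_right₀ _
      (infDist_edgeLine_pos b _).ne']
  exact and_congr_right fun hp => mem_homothety_vertex_iff b _ hk hp

theorem coord_centerOfMass (b : AffineBasis (Fin 3) ℝ Plane) (j : Fin 3) :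
    b.coord j (centerOfMass b) = 1 / 3 := by
  rw [centerOfMass, b.coord_apply_centroid (Finset.mem_univ j)]
  norm_num

theorem coord_le_of_mem_vertexRegion (b : AffineBasis (Fin 3) ℝ Plane) {i : Fin 3} {x : Plane}
    (hx : x ∈ vertexRegion b i) (j : Fin 3) : b.coord j x ≤ b.coord i x := by
  have hconv : Convex ℝ {p : Plane | 0 ≤ (b.coord i - b.coord j) p} :=
    (convex_Ici (0 : ℝ)).affine_preimage (b.coord i - b.coord j)
  have hmid : ∀ a c : Fin 3, (b.coord i - b.coord j) (midpoint ℝ (b a) (b c)) =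
      (b.coord i (b a) + b.coord i (b c)) / 2 - (b.coord j (b a) + b.coord j (b c)) / 2 := by
    intro a c
    rw [AffineMap.coe_sub, Pi.sub_apply, AffineMap.map_midpoint, AffineMap.map_midpoint]
    simp only [midpoint_eq_smul_add, smul_eq_mul, invOf_eq_inv]
    ring
  have h := convexHull_min (𝕜 := ℝ) (t := {p : Plane | 0 ≤ (b.coord i - b.coord j) p})
    ?_ hconv hx
  · simpa using h
  · rintro p (rfl | rfl | rfl | rfl)
    · change 0 ≤ b.coord i (b i) - b.coord j (b i)
      simp only [b.coord_apply]
      split_ifs <;> simp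
    · rw [Set.mem_ofPred_eq, hmid]
      simp only [b.coord_apply]
      fin_cases i <;> fin_cases j <;> simp
    · change 0 ≤ b.coord i (centerOfMass b) - b.coord j (centerOfMass b)
      rw [coord_centerOfMass, coord_centerOfMass, sub_self]
    · rw [Set.mem_ofPred_eq, hmid]
      simp only [b.coord_apply]
      fin_cases i <;> fin_cases j <;> simp

/-- The interior part of the vertex region of `b i`: the points of the triangle whose largest
barycentric coordinate is attained at `i` only. -/
def strictRegion (b : AffineBasis (Fin 3) ℝ Plane) (i : Fin 3) : Set Plane :=
  {z | z ∈ triangle b ∧ ∀ j, j ≠ i → b.coord j z < b.coord i z}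

theorem vertexAssignment_eq (b : AffineBasis (Fin 3) ℝ Plane) {v : Plane → Fin 3}
    (hv : IsVertexAssignment b v) {i : Fin 3} {z : Plane} (hz : z ∈ strictRegion b i)
    (hz' : z ∉ Set.range b) : v z = i := by
  by_contra h
  exact absurd (coord_le_of_mem_vertexRegion b (hv z ⟨hz.1, hz'⟩) i) (not_le.2 (hz.2 _ h))

theorem measurableSet_strictRegion (b : AffineBasis (Fin 3) ℝ Plane) (i : Fin 3) :
    MeasurableSet (strictRegion b i) := by
  have h : strictRegion b i =
      triangle b ∩ ⋂ j, ⋂ (_ : j ≠ i), {z | b.coord j z < b.coord i z} := by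
    ext z; simp [strictRegion]
  rw [h]
  refine (measurableSet_triangle b).inter (MeasurableSet.iInter fun j =>
    MeasurableSet.iInter fun _ => ?_)
  exact measurableSet_lt (continuous_coord b j).measurable (continuous_coord b i).measurable

theorem disjoint_strictRegion (b : AffineBasis (Fin 3) ℝ Plane) {i j : Fin 3} (hij : i ≠ j) :
    Disjoint (strictRegion b i) (strictRegion b j) :=
  Set.disjoint_left.2 fun _ h1 h2 => lt_asymm (h1.2 j hij.symm) (h2.2 i hij)

theorem volume_coord_eq_coord (b : AffineBasis (Fin 3) ℝ Plane) {i j : Fin 3} (hij : i ≠ j) :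
    volume {z : Plane | b.coord i z = b.coord j z} = 0 := by
  have h := Measure.addHaar_affineSubspace (volume : Measure Plane)
    ((AffineSubspace.mk' (0 : ℝ) ⊥).comap (b.coord i - b.coord j)) ?_
  · convert h using 2
    ext z
    simp [AffineSubspace.mem_mk', sub_eq_zero]
  · intro h
    have h1 : b i ∈ (AffineSubspace.mk' (0 : ℝ) ⊥).comap (b.coord i - b.coord j) := by
      rw [h]; exact AffineSubspace.mem_top _ _ _
    simp [AffineSubspace.mem_mk', b.coord_apply_ne hij.symm] at h1

theorem ae_mem_strictRegion (b : AffineBasis (Fin 3) ℝ Plane) :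
    ∀ᵐ z : Plane, z ∈ triangle b → ∃ i, z ∈ strictRegion b i := by
  have h : ∀ i j : Fin 3, ∀ᵐ z : Plane, i ≠ j → b.coord i z ≠ b.coord j z := by
    intro i j
    by_cases hij : i = j
    · simp [hij]
    · filter_upwards [compl_mem_ae_iff.2 (volume_coord_eq_coord b hij)] with z hz _ using hz
  filter_upwards [ae_all_iff.2 fun i => ae_all_iff.2 (h i)] with z hz hT
  obtain ⟨i, hi⟩ := Finite.exists_max fun i => b.coord i z
  exact ⟨i, hT, fun j hj => lt_of_le_of_ne (hi j) (hz j i hj)⟩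

theorem ae_notMem_vertices (y : Fin 3 → Plane) : ∀ᵐ z : Plane, z ∉ Set.range y :=
  compl_mem_ae_iff.2 ((Set.finite_range y).measure_zero volume)

/-! ### The pieces of the `Γ₁`-region -/

/-- The part in the vertex region of `b i` of the `Γ₁`-region of a set whose smallest barycentric
coordinate at `i` is `t`. -/
def gammaPiece (r : ℝ) (b : AffineBasis (Fin 3) ℝ Plane) (i : Fin 3) (t : ℝ) : Set Plane :=
  {z | z ∈ strictRegion b i ∧ 1 - t ≤ r * (1 - b.coord i z)}

theorem measurableSet_gammaPiece (r : ℝ) (b : AffineBasis (Fin 3) ℝ Plane) (i : Fin 3) (t : ℝ) :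
    MeasurableSet (gammaPiece r b i t) :=
  (measurableSet_strictRegion b i).inter <| measurableSet_le measurable_const
    ((measurable_const.sub (continuous_coord b i).measurable).const_mul r)

theorem gammaPiece_subset_triangle (r : ℝ) (b : AffineBasis (Fin 3) ℝ Plane) (i : Fin 3) (t : ℝ) :
    gammaPiece r b i t ⊆ triangle b := fun _ h => h.1.1

theorem volume_gammaPiece_ne_top (r : ℝ) (b : AffineBasis (Fin 3) ℝ Plane) (i : Fin 3) (t : ℝ) :
    volume (gammaPiece r b i t) ≠ ⊤ :=
  measure_ne_top_of_subset (gammaPiece_subset_triangle r b i t)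
    (isCompact_triangle b).measure_lt_top.ne

/-- The area of a piece is monotone in its parameter, hence measurable, whatever the choice of the
vertex assignment. -/
theorem measurable_volume_gammaPiece (r : ℝ) (b : AffineBasis (Fin 3) ℝ Plane) (i : Fin 3) :
    Measurable fun t => volume.real (gammaPiece r b i t) := by
  refine Monotone.measurable fun s t hst => ?_
  exact measureReal_mono (fun z hz => ⟨hz.1, by linarith [hz.2]⟩) (volume_gammaPiece_ne_top r b i t)

/-- Up to a null set, the `Γ₁`-region of a subset of the triangle is the disjoint union of three
pieces, which depend on the set only through its smallest barycentric coordinates. -/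
theorem gammaOneArea_eq_sum (b : AffineBasis (Fin 3) ℝ Plane) {v : Plane → Fin 3}
    (hv : IsVertexAssignment b v) {r : ℝ} (hr : 0 < r) {B : Set Plane} (hB : B ⊆ triangle b)
    {m : Fin 3 → ℝ} (hm : ∀ i c, c ≤ m i ↔ ∀ p ∈ B, c ≤ b.coord i p) :
    gammaOneArea r b v B = ∑ i, volume.real (gammaPiece r b i (m i)) := by
  have hae : gammaOne (triangle b) (propEdge r b v) B =ᵐ[volume]
      ⋃ i, gammaPiece r b i (m i) := by
    filter_upwards [ae_mem_strictRegion b, ae_notMem_vertices b] with z hreg hvert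
    refine propext ?_
    change z ∈ gammaOne _ _ _ ↔ z ∈ ⋃ i, _
    rw [Set.mem_iUnion]
    have key : ∀ i, z ∈ strictRegion b i →
        (B ⊆ propEdge r b v z ↔ 1 - m i ≤ r * (1 - b.coord i z)) := by
      intro i hi
      have hvi := vertexAssignment_eq b hv hi hvert
      have h1 := hm i (1 - r * (1 - b.coord i z))
      constructor
      · intro h
        have := h1.2 fun p hp => by
          have := ((mem_propEdge_iff b v hr hi.1 hvert).1 (h hp)).2
          rw [hvi] at this
          linarith
        linarith
      · intro h p hp
        refine (mem_propEdge_iff b v hr hi.1 hvert).2 ⟨hB hp, ?_⟩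
        rw [hvi]
        have := h1.1 (by linarith) p hp
        linarith
    constructor
    · rintro ⟨hT, h⟩
      obtain ⟨i, hi⟩ := hreg hT
      exact ⟨i, hi, (key i hi).1 h⟩
    · rintro ⟨i, hi, h⟩
      exact ⟨hi.1, (key i hi).2 h⟩
  rw [gammaOneArea, measureReal_congr hae, measureReal_iUnion_fintype
    (fun i j hij => (disjoint_strictRegion b hij).mono (fun _ h => h.1) (fun _ h => h.1))
    (fun i => measurableSet_gammaPiece r b i (m i))
    (fun i => volume_gammaPiece_ne_top r b i (m i))]

/-- For `r = 3/2` the condition `1 - t ≤ r (1 - λᵢ)` reads `λᵢ ≤ 1/3 + 2t/3`. As `λᵢ` is the largest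
coordinate, the piece is contained in the image of the triangle under the homothety about the
center of mass with ratio `-2t`, so its area is quadratic in `t`. -/
theorem volume_gammaPiece_le (b : AffineBasis (Fin 3) ℝ Plane) (i : Fin 3) {t : ℝ} (ht : 0 ≤ t) :
    volume.real (gammaPiece (3 / 2) b i t) ≤ 4 * volume.real (triangle b) * t ^ 2 := by
  rcases ht.eq_or_lt with rfl | ht
  -- At `t = 0` all three coordinates would be at most `1/3`, two of them strictly less.
  · have h : gammaPiece (3 / 2) b i 0 = ∅ := by
      refine Set.eq_empty_of_forall_notMem fun z hz => ?_
      have hs := b.sum_coord_apply_eq_one z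
      have h1 := hz.1.2 (i + 1) (by fin_cases i <;> decide)
      have h2 := hz.1.2 (i + 2) (by fin_cases i <;> decide)
      have h3 := hz.2
      rw [Fin.sum_univ_three] at hs
      fin_cases i <;> simp at h1 h2 h3 <;> linarith
    simp [h]
  · have hk : -(2 * t) ≠ 0 := by linarith
    have hsub : gammaPiece (3 / 2) b i t ⊆
        AffineMap.homothety (centerOfMass b) (-(2 * t)) '' triangle b := by
      intro z hz
      rw [mem_homothety_image_iff hk, mem_triangle_iff]
      intro j
      rw [coord_homothety, coord_centerOfMass]
      have hj : b.coord j z ≤ b.coord i z := by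
        by_cases h : j = i
        · rw [h]
        · exact (hz.1.2 j h).le
      have h2 := hz.2
      have h3 : (2 * t)⁻¹ * (b.coord j z - 1 / 3) ≤ 1 / 3 := by
        rw [inv_mul_le_iff₀ (by linarith)]
        linarith
      rw [inv_neg]
      linarith
    have hvol := Measure.addHaar_image_homothety (volume : Measure Plane) (centerOfMass b)
      (-(2 * t)) (triangle b)
    have hfin : volume (AffineMap.homothety (centerOfMass b) (-(2 * t)) '' triangle b) ≠ ⊤ := by
      rw [hvol]
      exact ENNReal.mul_ne_top ENNReal.ofReal_ne_top (isCompact_triangle b).measure_lt_top.ne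
    refine (measureReal_mono hsub hfin).trans_eq ?_
    rw [measureReal_def, hvol, ENNReal.toReal_mul, ENNReal.toReal_ofReal (abs_nonneg _),
      finrank_euclideanSpace_fin, abs_of_nonneg (by positivity), measureReal_def]
    ring

end ProximityMap

namespace ProximityMap

/-! ### The smallest barycentric coordinate of a uniform sample -/

/-- For `0 ≤ t ≤ 1` the corner `{λᵢ > t}` is the triangle scaled by `1 - t`, so its probability is
`(1 - t)²`. The exponential bound holds for all `t`. -/
theorem cond_coord_gt_le (b : AffineBasis (Fin 3) ℝ Plane) (i : Fin 3) (t : ℝ) :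
    (volume[|triangle b]) {p | t < b.coord i p} ≤ ENNReal.ofReal (Real.exp (-(2 * t))) := by
  rw [cond_apply (measurableSet_triangle b)]
  rcases lt_or_ge t 1 with h1 | h1
  · have hsub : triangle b ∩ {p | t < b.coord i p} ⊆
        AffineMap.homothety (b i) (1 - t) '' triangle b := by
      rintro p ⟨hp, hpt⟩
      rw [Set.mem_ofPred_eq] at hpt
      exact (mem_homothety_vertex_iff b i (by linarith) hp).2 (by linarith)
    have hsq : |(1 - t) ^ 2| ≤ Real.exp (-(2 * t)) := by
      have hexp : Real.exp (-(2 * t)) = Real.exp (-t) ^ 2 := by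
        rw [← Real.exp_nat_mul]
        congr 1
        push_cast
        ring
      rw [abs_of_nonneg (sq_nonneg _), hexp]
      exact pow_le_pow_left₀ (by linarith) (Real.one_sub_le_exp_neg t) 2
    calc (volume (triangle b))⁻¹ * volume (triangle b ∩ {p | t < b.coord i p})
        ≤ (volume (triangle b))⁻¹ * (ENNReal.ofReal |(1 - t) ^ 2| * volume (triangle b)) := by
          gcongr
          refine (measure_mono hsub).trans_eq ?_
          rw [Measure.addHaar_image_homothety, finrank_euclideanSpace_fin]
      _ = ENNReal.ofReal |(1 - t) ^ 2| * ((volume (triangle b))⁻¹ * volume (triangle b)) := by ring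
      _ ≤ ENNReal.ofReal |(1 - t) ^ 2| * 1 := by gcongr; exact ENNReal.inv_mul_le_one _
      _ ≤ ENNReal.ofReal (Real.exp (-(2 * t))) := by
          rw [mul_one]; exact ENNReal.ofReal_le_ofReal hsq
  · have h : triangle b ∩ {p | t < b.coord i p} = ∅ := by
      refine Set.eq_empty_of_forall_notMem fun p ⟨hp, hpt⟩ => ?_
      rw [Set.mem_ofPred_eq] at hpt
      rw [mem_triangle_iff] at hp
      have hs := b.sum_coord_apply_eq_one p
      rw [← Finset.add_sum_erase _ _ (Finset.mem_univ i)] at hs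
      have := Finset.sum_nonneg fun j (_ : j ∈ Finset.univ.erase i) => hp j
      linarith
    simp [h]

section Sample

variable {Ω : Type*} [MeasurableSpace Ω] {P : Measure Ω} {n : ℕ} {X : Fin n → Ω → Plane}

theorem ae_sample_mem_triangle (b : AffineBasis (Fin 3) ℝ Plane)
    (hlaw : ∀ k, HasLaw (X k) (volume[|triangle b]) P) :
    ∀ᵐ ω ∂P, ∀ k, X k ω ∈ triangle b := by
  refine ae_all_iff.2 fun k => ?_
  have h := ae_cond_mem (μ := (volume : Measure Plane)) (measurableSet_triangle b)
  rw [← (hlaw k).map_eq] at h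
  exact ae_of_ae_map (hlaw k).aemeasurable h

theorem aemeasurable_iInf_coord (b : AffineBasis (Fin 3) ℝ Plane)
    (hlaw : ∀ k, HasLaw (X k) (volume[|triangle b]) P) (i : Fin 3) :
    AEMeasurable (fun ω => ⨅ k, b.coord i (X k ω)) P :=
  AEMeasurable.iInf fun k => (continuous_coord b i).measurable.comp_aemeasurable
    (hlaw k).aemeasurable

theorem measure_lt_iInf_coord_le (b : AffineBasis (Fin 3) ℝ Plane)
    (hlaw : ∀ k, HasLaw (X k) (volume[|triangle b]) P) (hindep : iIndepFun X P)
    (i : Fin 3) (t : ℝ) :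
    P {ω | t < ⨅ k, b.coord i (X k ω)} ≤ ENNReal.ofReal (Real.exp (-(2 * n * t))) := by
  have hmeas : MeasurableSet {p : Plane | t < b.coord i p} :=
    measurableSet_lt measurable_const (continuous_coord b i).measurable
  have hsub : {ω | t < ⨅ k, b.coord i (X k ω)} ⊆
      ⋂ k ∈ Finset.univ, X k ⁻¹' {p : Plane | t < b.coord i p} := by
    intro ω hω
    simp only [Set.mem_iInter]
    exact fun k _ => lt_of_lt_of_le (show t < ⨅ k, b.coord i (X k ω) from hω)
      (ciInf_le (Set.finite_range _).bddBelow k)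
  calc P {ω | t < ⨅ k, b.coord i (X k ω)}
      ≤ ∏ k : Fin n, P (X k ⁻¹' {p : Plane | t < b.coord i p}) := by
        rw [← hindep.measure_inter_preimage_eq_mul Finset.univ fun _ _ => hmeas]
        exact measure_mono hsub
    _ ≤ ∏ _k : Fin n, ENNReal.ofReal (Real.exp (-(2 * t))) := by
        refine Finset.prod_le_prod' fun k _ => ?_
        rw [← Measure.map_apply_of_aemeasurable (hlaw k).aemeasurable hmeas, (hlaw k).map_eq]
        exact cond_coord_gt_le b i t
    _ = ENNReal.ofReal (Real.exp (-(2 * n * t))) := by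
        rw [Finset.prod_const, Finset.card_univ, Fintype.card_fin,
          ← ENNReal.ofReal_pow (Real.exp_pos _).le, ← Real.exp_nat_mul]
        congr 2
        ring

/-- The layer cake formula turns the exponential tail of the smallest coordinate into a bound of
order `n⁻²` for its second moment. -/
theorem lintegral_sq_iInf_coord_le (b : AffineBasis (Fin 3) ℝ Plane)
    (hlaw : ∀ k, HasLaw (X k) (volume[|triangle b]) P) (hindep : iIndepFun X P)
    (hn : 0 < n) (i : Fin 3) :
    ∫⁻ ω, ENNReal.ofReal ((⨅ k, b.coord i (X k ω)) ^ 2) ∂P ≤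
      ENNReal.ofReal (1 / (2 * (n : ℝ) ^ 2)) := by
  have : Nonempty (Fin n) := ⟨⟨0, hn⟩⟩
  have hn' : (0 : ℝ) < 2 * n := by positivity
  have hnonneg : 0 ≤ᵐ[P] fun ω => ⨅ k, b.coord i (X k ω) := by
    filter_upwards [ae_sample_mem_triangle b hlaw] with ω hω
    exact le_ciInf fun k => (mem_triangle_iff b).1 (hω k) i
  have hlayer := lintegral_rpow_eq_lintegral_meas_lt_mul P hnonneg
    (aemeasurable_iInf_coord b hlaw i) (p := 2) two_pos
  have hgamma := Real.integral_rpow_mul_exp_neg_mul_Ioi (a := 2) two_pos hn'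
  norm_num at hlayer hgamma
  have hint : IntegrableOn (fun t : ℝ => t * Real.exp (-(2 * n * t))) (Set.Ioi 0) := by
    -- A non-integrable function would have integral zero.
    refine Integrable.of_integral_ne_zero ?_
    rw [hgamma]
    positivity
  rw [hlayer]
  calc 2 * ∫⁻ t in Set.Ioi 0, P {ω | t < ⨅ k, b.coord i (X k ω)} * ENNReal.ofReal t
      ≤ 2 * ∫⁻ t in Set.Ioi (0 : ℝ), ENNReal.ofReal (t * Real.exp (-(2 * n * t))) := by
        refine mul_le_mul_right (setLIntegral_mono' measurableSet_Ioi fun t ht => ?_) _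
        rw [Set.mem_Ioi] at ht
        rw [ENNReal.ofReal_mul ht.le, mul_comm]
        exact mul_le_mul_right (measure_lt_iInf_coord_le b hlaw hindep i t) _
    _ = 2 * ENNReal.ofReal (∫ t in Set.Ioi (0 : ℝ), t * Real.exp (-(2 * n * t))) := by
        rw [ofReal_integral_eq_lintegral_ofReal hint]
        filter_upwards [ae_restrict_mem measurableSet_Ioi] with t ht
        rw [Set.mem_Ioi] at ht
        positivity
    _ = ENNReal.ofReal (1 / (2 * (n : ℝ) ^ 2)) := by
        rw [hgamma, show (2 : ENNReal) = ENNReal.ofReal 2 by simp,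
          ← ENNReal.ofReal_mul zero_le_two]
        congr 1
        field_simp

/-! ### The expected area -/

theorem gammaOneArea_sample_ae_eq (b : AffineBasis (Fin 3) ℝ Plane) {v : Plane → Fin 3}
    (hv : IsVertexAssignment b v) {r : ℝ} (hr : 0 < r)
    (hlaw : ∀ k, HasLaw (X k) (volume[|triangle b]) P) (hn : 0 < n) :
    (fun ω => gammaOneArea r b v (Set.range fun k => X k ω)) =ᵐ[P]
      fun ω => ∑ i, volume.real (gammaPiece r b i (⨅ k, b.coord i (X k ω))) := by
  have : Nonempty (Fin n) := ⟨⟨0, hn⟩⟩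
  filter_upwards [ae_sample_mem_triangle b hlaw] with ω hω
  refine gammaOneArea_eq_sum b hv hr (Set.range_subset_iff.2 hω) fun i c => ?_
  rw [le_ciInf_iff (Set.finite_range _).bddBelow, Set.forall_mem_range]

theorem integrable_gammaOneArea [IsProbabilityMeasure P] (b : AffineBasis (Fin 3) ℝ Plane)
    {v : Plane → Fin 3} (hv : IsVertexAssignment b v) {r : ℝ} (hr : 0 < r)
    (hlaw : ∀ k, HasLaw (X k) (volume[|triangle b]) P) :
    Integrable (fun ω => gammaOneArea r b v (Set.range fun k => X k ω)) P := by
  rcases n.eq_zero_or_pos with rfl | hn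
  -- The empty sample gives the whole triangle, a constant.
  · simp only [Set.range_eq_empty]
    exact integrable_const _
  · have hae := gammaOneArea_sample_ae_eq b hv hr hlaw hn
    have hmeas : AEStronglyMeasurable
        (fun ω => gammaOneArea r b v (Set.range fun k => X k ω)) P := by
      refine AEStronglyMeasurable.congr (AEMeasurable.aestronglyMeasurable ?_) hae.symm
      exact Finset.aemeasurable_fun_sum _ fun i _ =>
        (measurable_volume_gammaPiece r b i).comp_aemeasurable (aemeasurable_iInf_coord b hlaw i)
    refine Integrable.of_bound hmeas (volume.real (triangle b)) (ae_of_all _ fun ω => ?_)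
    rw [gammaOneArea, Real.norm_of_nonneg measureReal_nonneg]
    exact measureReal_mono (fun _ h => h.1) (isCompact_triangle b).measure_lt_top.ne

theorem integral_gammaOneArea_le [IsProbabilityMeasure P] (b : AffineBasis (Fin 3) ℝ Plane)
    {v : Plane → Fin 3} (hv : IsVertexAssignment b v)
    (hlaw : ∀ k, HasLaw (X k) (volume[|triangle b]) P) (hindep : iIndepFun X P) (hn : 0 < n) :
    ∫ ω, gammaOneArea (3 / 2) b v (Set.range fun k => X k ω) ∂P ≤
      6 * volume.real (triangle b) / (n : ℝ) ^ 2 := by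
  have : Nonempty (Fin n) := ⟨⟨0, hn⟩⟩
  set V := volume.real (triangle b)
  have hV0 : 0 ≤ V := measureReal_nonneg
  have hmeas : ∀ i, AEMeasurable
      (fun ω => ENNReal.ofReal (4 * V * (⨅ k, b.coord i (X k ω)) ^ 2)) P := fun i =>
    (((aemeasurable_iInf_coord b hlaw i).pow_const 2).const_mul _).ennreal_ofReal
  rw [integral_eq_lintegral_of_nonneg_ae
    (ae_of_all _ fun ω => show 0 ≤ gammaOneArea _ _ _ _ from measureReal_nonneg)
    (integrable_gammaOneArea b hv (by norm_num) hlaw).aestronglyMeasurable]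
  refine ENNReal.toReal_le_of_le_ofReal (by positivity) ?_
  calc ∫⁻ ω, ENNReal.ofReal (gammaOneArea (3 / 2) b v (Set.range fun k => X k ω)) ∂P
      ≤ ∫⁻ ω, ∑ i, ENNReal.ofReal (4 * V * (⨅ k, b.coord i (X k ω)) ^ 2) ∂P := by
        refine lintegral_mono_ae ?_
        filter_upwards [gammaOneArea_sample_ae_eq b hv (r := 3 / 2) (by norm_num) hlaw hn,
          ae_sample_mem_triangle b hlaw] with ω h hω
        rw [h, ← ENNReal.ofReal_sum_of_nonneg fun i _ => by positivity]
        refine ENNReal.ofReal_le_ofReal (Finset.sum_le_sum fun i _ => ?_)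
        exact volume_gammaPiece_le b i (le_ciInf fun k => (mem_triangle_iff b).1 (hω k) i)
    _ = ∑ i, ∫⁻ ω, ENNReal.ofReal (4 * V * (⨅ k, b.coord i (X k ω)) ^ 2) ∂P :=
        lintegral_finsetSum' _ fun i _ => hmeas i
    _ ≤ ∑ _i : Fin 3, ENNReal.ofReal (2 * V / (n : ℝ) ^ 2) := by
        refine Finset.sum_le_sum fun i _ => ?_
        simp_rw [ENNReal.ofReal_mul (show 0 ≤ 4 * V by positivity)]
        rw [lintegral_const_mul' _ _ ENNReal.ofReal_ne_top]
        refine (mul_le_mul_right (lintegral_sq_iInf_coord_le b hlaw hindep hn i) _).trans_eq ?_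
        rw [← ENNReal.ofReal_mul (by positivity)]
        congr 1
        field_simp
        ring
    _ = ENNReal.ofReal (6 * V / (n : ℝ) ^ 2) := by
        rw [← ENNReal.ofReal_sum_of_nonneg fun i _ => by positivity]
        congr 1
        rw [Finset.sum_const, Finset.card_univ, Fintype.card_fin, nsmul_eq_mul]
        push_cast
        ring

end Sample

end ProximityMap

theorem mainTheorem8
    (y : Fin 3 → ProximityMap.Plane) (hy : AffineIndependent ℝ y)
    (v : ProximityMap.Plane → Fin 3) (hv : ProximityMap.IsVertexAssignment y v)
    {Ω : ℕ → Type*} [∀ n, MeasurableSpace (Ω n)]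
    (P : (n : ℕ) → Measure (Ω n)) [∀ n, IsProbabilityMeasure (P n)]
    (X : (n : ℕ) → Fin n → Ω n → ProximityMap.Plane)
    (hlaw : ∀ n i, HasLaw (X n i) (volume[|ProximityMap.triangle y]) (P n))
    (hindep : ∀ n, iIndepFun (X n) (P n)) :
    (∀ n, Integrable (fun ω => ProximityMap.gammaOneArea (3 / 2) y v
      (Set.range fun i => X n i ω)) (P n)) ∧
    Tendsto (fun n => ∫ ω, ProximityMap.gammaOneArea (3 / 2) y v
      (Set.range fun i => X n i ω) ∂(P n)) atTop (𝓝 0) ∧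
    (fun n => ∫ ω, ProximityMap.gammaOneArea (3 / 2) y v
      (Set.range fun i => X n i ω) ∂(P n)) =O[atTop] (fun n : ℕ => (n : ℝ) ^ (-2 : ℤ)) := by
  have htop : affineSpan ℝ (Set.range y) = ⊤ :=
    hy.affineSpan_eq_top_iff_card_eq_finrank_add_one.2 (by simp)
  obtain ⟨b, rfl⟩ : ∃ b : AffineBasis (Fin 3) ℝ ProximityMap.Plane, ⇑b = y := ⟨⟨y, hy, htop⟩, rfl⟩
  have hO : (fun n => ∫ ω, ProximityMap.gammaOneArea (3 / 2) b v
      (Set.range fun i => X n i ω) ∂(P n)) =O[atTop] (fun n : ℕ => (n : ℝ) ^ (-2 : ℤ)) := by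
    refine IsBigO.of_bound (6 * volume.real (ProximityMap.triangle b)) ?_
    filter_upwards [eventually_gt_atTop 0] with n hn
    have h0 : 0 ≤ ∫ ω, ProximityMap.gammaOneArea (3 / 2) b v
        (Set.range fun i => X n i ω) ∂(P n) := integral_nonneg fun _ => measureReal_nonneg
    rw [Real.norm_of_nonneg h0, Real.norm_of_nonneg (by positivity), zpow_neg, ← div_eq_mul_inv]
    exact_mod_cast ProximityMap.integral_gammaOneArea_le b hv (hlaw n) (hindep n) hn
  refine ⟨fun n => ProximityMap.integrable_gammaOneArea b hv (by norm_num) (hlaw n),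
    hO.trans_tendsto ?_, hO⟩
  exact (tendsto_zpow_atTop_zero (𝕜 := ℝ) (by norm_num)).comp tendsto_natCast_atTop_atTop
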